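/- Let $n\ge 1$ be an integer and let $M$ be a matroid on $[n]=\{1,\dots,n\}$ with rank function $\mathrm{rk}$ and nullity $\mathrm{null}(S)=|S|-\mathrm{rk}(S)$. Let $$A^*(U_{n,n})=\frac{\mathbb Z[x_S:\emptyset\ne S\subseteq[n]]}{\langle x_Sx_T: S\not\subseteq T,\ T\not\subseteq S\rangle+\langle \sum_{S\ni e}x_S : e\in[n]\rangle}$$ be the Chow ring of the free matroid $U_{n,n}$, graded by polynomial degree. The rank-nullity ring of $M$ is the graded subring $$R^*(M)=\mathbb Z[y_{i,j}:0\le i,j\le n]\subseteq A^*(U_{n,n}),\qquad y_{i,j}=\sum_{\substack{\emptyset\ne S\subseteq[n]\\ \mathrm{rk}(S)=i,\ \mathrm{null}(S)=j}}x_S,$$ with graded pieces $R^k(M)=R^*(M)\cap A^k(U_{n,n})$. Then $R^*(M)$ has highest non-zero degree equal to $n-1$: one has $$\mathrm{rank}_{\mathbb Z}\,R^{n-1}(M)=1\qquad\text{and}\qquad R^k(M)=0\ \text{ for all } k>n-1.$$ Moreover, there is a unique group isomorphism $\deg:A^{n-1}(U_{n,n})\to\mathbb Z$ with $\deg(x_{S_1}\cdots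 x_{S_{n-1}})=1$ for every chain $\emptyset\subsetneq S_1\subsetneq\cdots\subsetneq S_{n-1}\subsetneq[n]$, and, writing $z_k=\sum_{|S|=k}x_S$, the product $\prod_{k=1}^{n-1}z_k$ lies in $R^{n-1}(M)$ and satisfies $\deg\bigl(\prod_{k=1}^{n-1}z_k\bigr)=n!$. -/

import Mathlib

open MvPolynomial

namespace Matroid

section

variable {α : Type*}

/-- The nonempty flats of a matroid on a finite type, ordered by inclusion. -/
abbrev NonemptyFlat (M : Matroid α) : Type _ :=
  {F : Finset α // F.Nonempty ∧ M.IsFlat (F : Set α)}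

/-- The ideal of relations of the Chow ring: the products `x_F x_{F'}` with `F`, `F'` incomparable,
and the sums `∑_{F ∋ e} x_F` for `e` in the ground set. -/
noncomputable def chowIdeal [Fintype α] (M : Matroid α) : Ideal (MvPolynomial M.NonemptyFlat ℤ) :=
  open Classical in
  Ideal.span {p | ∃ F F' : M.NonemptyFlat, ¬ F.1 ⊆ F'.1 ∧ ¬ F'.1 ⊆ F.1 ∧ p = X F * X F'} ⊔
  Ideal.span {p | ∃ e ∈ M.E, p = ∑ F : M.NonemptyFlat with e ∈ F.1, X F}

/-- The Chow ring `A^*(M)` of a matroid, in the Feichtner-Yuzvinsky presentation over `ℤ`. -/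
abbrev ChowRing [Fintype α] (M : Matroid α) : Type _ :=
  MvPolynomial M.NonemptyFlat ℤ ⧸ M.chowIdeal

/-- The generator `x_F` of the Chow ring. -/
noncomputable def chowX [Fintype α] (M : Matroid α) (F : M.NonemptyFlat) : M.ChowRing :=
  Ideal.Quotient.mk M.chowIdeal (X F)

/-- The graded piece `A^k(M)`: classes of homogeneous polynomials of degree `k`. -/
noncomputable def chowGraded [Fintype α] (M : Matroid α) (k : ℕ) : Submodule ℤ M.ChowRing :=
  (homogeneousSubmodule M.NonemptyFlat ℤ k).map (Ideal.Quotient.mkₐ ℤ M.chowIdeal).toLinearMap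

theorem prod_chowX_mem_chowGraded [Fintype α] (M : Matroid α) {k : ℕ} (S : Fin k → M.NonemptyFlat) :
    ∏ i, M.chowX (S i) ∈ M.chowGraded k := by
  refine ⟨∏ i, X (S i), ?_, ?_⟩
  · have h := IsHomogeneous.prod Finset.univ (fun i => (X (S i) : MvPolynomial M.NonemptyFlat ℤ))
      (fun _ => 1) (fun i _ => isHomogeneous_X ℤ (S i))
    simpa using h
  · simp [chowX, map_prod]

/-- The rank function, as a natural number. -/
noncomputable def natRk (M : Matroid α) (S : Finset α) : ℕ := (M.eRk (S : Set α)).toNat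

theorem coe_natRk (M : Matroid α) (S : Finset α) : (M.natRk S : ℕ∞) = M.eRk (S : Set α) :=
  ENat.natCast_toNat (ne_top_of_le_ne_top (by simp) (M.eRk_le_encard (S : Set α)))

theorem natRk_le_card (M : Matroid α) (S : Finset α) : M.natRk S ≤ S.card := by
  have h := M.eRk_le_encard (S : Set α)
  rw [← coe_natRk, Set.encard_coe_eq_coe_finsetCard] at h
  exact_mod_cast h

/-- The nullity `|S| - rk S` (the subtraction never truncates, by `natRk_le_card`). -/
noncomputable def natNullity (M : Matroid α) (S : Finset α) : ℕ := S.card - M.natRk S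

end

/-- The free matroid `U_{n,n}` on `Fin n`. -/
abbrev freeFin (n : ℕ) : Matroid (Fin n) := freeOn Set.univ

/-- Every subset is a flat of the free matroid, so that the generators of `A^*(U_{n,n})` are
indexed by all nonempty subsets. -/
theorem isFlat_freeFin {n : ℕ} (S : Finset (Fin n)) : (freeFin n).IsFlat (S : Set (Fin n)) := by
  refine ⟨fun I Y hI hY => ?_, by simp⟩
  have h1 : I = (S : Set (Fin n)) :=
    hI.eq_of_subset_indep (J := (S : Set (Fin n))) (by simp) hI.subset subset_rfl
  have h2 : I = Y := hY.eq_of_subset_indep (by simp) hY.subset subset_rfl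
  rw [← h2, h1]

/-- The element `y_{i,j} = ∑_{rk S = i, null S = j} x_S` of `A^*(U_{n,n})`, over nonempty `S`. -/
noncomputable def rankNullityY {n : ℕ} (M : Matroid (Fin n)) (i j : ℕ) : (freeFin n).ChowRing :=
  open Classical in
  ∑ S : (freeFin n).NonemptyFlat with M.natRk S.1 = i ∧ M.natNullity S.1 = j, (freeFin n).chowX S

/-- The rank-nullity ring `R^*(M) = ℤ[y_{i,j} : 0 ≤ i, j ≤ n]`, a subring of `A^*(U_{n,n})`. -/
noncomputable def rankNullityRing {n : ℕ} (M : Matroid (Fin n)) :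
    Subalgebra ℤ (freeFin n).ChowRing :=
  Algebra.adjoin ℤ {y | ∃ i ≤ n, ∃ j ≤ n, y = M.rankNullityY i j}

/-- The graded piece `R^k(M) = R^*(M) ∩ A^k(U_{n,n})`. -/
noncomputable def rankNullityGraded {n : ℕ} (M : Matroid (Fin n)) (k : ℕ) :
    Submodule ℤ (freeFin n).ChowRing :=
  Subalgebra.toSubmodule M.rankNullityRing ⊓ (freeFin n).chowGraded k

/-- The element `z_k = ∑_{|S| = k} x_S` of `A^*(U_{n,n})`, over nonempty `S`. -/
noncomputable def permutahedralZ (n k : ℕ) : (freeFin n).ChowRing :=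
  open Classical in
  ∑ S : (freeFin n).NonemptyFlat with S.1.card = k, (freeFin n).chowX S

/-- A group isomorphism `A^{n-1}(U_{n,n}) ≅ ℤ` is the degree isomorphism if it sends every monomial
`x_{S_1} ⋯ x_{S_{n-1}}` with `∅ ⊊ S_1 ⊊ ⋯ ⊊ S_{n-1} ⊊ [n]` to `1`. -/
def IsDegreeIso {n : ℕ} (deg : (freeFin n).chowGraded (n - 1) ≃ₗ[ℤ] ℤ) : Prop :=
  ∀ S : Fin (n - 1) → (freeFin n).NonemptyFlat,
    StrictMono S → (∀ i, (S i).1 ≠ Finset.univ) →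
      deg ⟨∏ i, (freeFin n).chowX (S i), (freeFin n).prod_chowX_mem_chowGraded S⟩ = 1

end Matroid

open MvPolynomial

namespace Matroid

open scoped Classical

/-! The ring is the Chow ring of the permutohedral variety, and the proof bounds its top degree from
both sides. Upper bound: the relations trade a repeated factor or a factor `x_{[n]}` for new proper
subsets, so square-free monomials of proper chains span each graded piece
(`monomial_mem_of_chain_mem`, `chowGraded_le`). Such chains have at most `n - 1` members, and two
complete flags differing by an adjacent transposition have the same class (`flagClass_swap_mul`), so
the top piece is cyclic. Lower bound: `localizedDegree` is the Atiyah–Bott sum over the torus fixed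
points, i.e. the orderings of `[n]`, with equivariant parameters specialised to `t_e = e`. It is 1
on complete flags and 0 on all monomials of degree below `n - 1`, hence kills the degree `n - 1`
part of the Chow ideal (`localizedDegree_eq_zero_of_mem_chowIdeal`), so the top piece is free of
rank one. At each fixed point `∏ z_k` restricts to the Euler class, so its degree counts the `n!`
orderings. Since `z_k` is a sum of `y_{i,j}` with `i + j = k`, this product lies in `R^{n-1}(M)`,
which is therefore a nonzero subgroup of `ℤ`. -/

/-! ### Reduction of monomials to square-free chains -/

/-- An element of `S` outside all members of a chain strictly below `S`. -/
theorem exists_mem_notMem_of_lt {n : ℕ} {C : Finset (freeFin n).NonemptyFlat}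
    (hC : IsChain (· ≤ ·) (C : Set (freeFin n).NonemptyFlat)) (S : (freeFin n).NonemptyFlat) :
    ∃ i ∈ S.1, ∀ T ∈ C, T < S → i ∉ T.1 := by
  rcases (C.filter (· < S)).eq_empty_or_nonempty with h | h
  · obtain ⟨i, hi⟩ := S.2.1
    exact ⟨i, hi, fun T hT hTS => absurd hTS (Finset.filter_eq_empty_iff.1 h hT)⟩
  · obtain ⟨P, hP⟩ := Finset.exists_maximal h
    have hPC := Finset.mem_filter.1 hP.prop
    obtain ⟨i, hiS, hiP⟩ := Finset.exists_of_ssubset (show P.1 ⊂ S.1 from hPC.2)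
    refine ⟨i, hiS, fun T hT hTS hi => hiP ?_⟩
    rcases hC.total hT hPC.1 with h' | h'
    · exact h' hi
    · exact hP.le_of_ge (Finset.mem_filter.2 ⟨hT, hTS⟩) h' hi

/-- An element outside `S` lying in all members of a chain strictly above `S`. -/
theorem exists_notMem_mem_of_lt {n : ℕ} {C : Finset (freeFin n).NonemptyFlat}
    (hC : IsChain (· ≤ ·) (C : Set (freeFin n).NonemptyFlat)) {S : (freeFin n).NonemptyFlat}
    (hS : S.1 ≠ Finset.univ) :
    ∃ j ∉ S.1, ∀ T ∈ C, S < T → j ∈ T.1 := by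
  rcases (C.filter (S < ·)).eq_empty_or_nonempty with h | h
  · obtain ⟨j, hj⟩ : ∃ j, j ∉ S.1 := by
      by_contra! h'
      exact hS (Finset.eq_univ_of_forall h')
    exact ⟨j, hj, fun T hT hTS => absurd hTS (Finset.filter_eq_empty_iff.1 h hT)⟩
  · obtain ⟨P, hP⟩ := Finset.exists_minimal h
    have hPC := Finset.mem_filter.1 hP.prop
    obtain ⟨j, hjP, hjS⟩ := Finset.exists_of_ssubset (show S.1 ⊂ P.1 from hPC.2)
    refine ⟨j, hjS, fun T hT hTS => ?_⟩
    rcases hC.total hT hPC.1 with h' | h'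
    · exact hP.le_of_le (Finset.mem_filter.2 ⟨hT, hTS⟩) h' hjP
    · exact h' hjP

/-- The linear relation `∑_{S ∋ e} x_S`. -/
noncomputable def linearRelation {n : ℕ} (e : Fin n) : MvPolynomial (freeFin n).NonemptyFlat ℤ :=
  ∑ S : (freeFin n).NonemptyFlat with e ∈ S.1, X S

theorem linearRelation_mul_monomial {n : ℕ} (e : Fin n) (m : (freeFin n).NonemptyFlat →₀ ℕ) :
    linearRelation e * monomial m 1 =
      ∑ S : (freeFin n).NonemptyFlat with e ∈ S.1, monomial (m + Finsupp.single S 1) (1 : ℤ) := by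
  rw [linearRelation, Finset.sum_mul]
  refine Finset.sum_congr rfl fun S _ => ?_
  rw [X, monomial_mul, add_comm, one_mul]

theorem support_add_single {ι : Type*} [DecidableEq ι] (m : ι →₀ ℕ) (S : ι) :
    (m + Finsupp.single S 1).support = insert S m.support := by
  ext T
  by_cases h : T = S
  · subst h; simp
  · simp [h]

/-- A group of polynomials containing the square-free monomials of chains of proper subsets, the
monomials of non-chains, and the multiples of the linear relations, contains all monomials. -/
theorem monomial_mem_of_chain_mem {n k : ℕ}
    (N : Submodule ℤ (MvPolynomial (freeFin n).NonemptyFlat ℤ))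
    (hchain : ∀ C : Finset (freeFin n).NonemptyFlat,
      IsChain (· ≤ ·) (C : Set (freeFin n).NonemptyFlat) → (∀ S ∈ C, S.1 ≠ Finset.univ) →
      C.card = k → ∏ S ∈ C, X S ∈ N)
    (hinc : ∀ m : (freeFin n).NonemptyFlat →₀ ℕ, m.degree = k →
      ¬ IsChain (· ≤ ·) (m.support : Set (freeFin n).NonemptyFlat) → monomial m 1 ∈ N)
    (hlin : ∀ (e : Fin n) (m : (freeFin n).NonemptyFlat →₀ ℕ), m.degree + 1 = k →
      linearRelation e * monomial m 1 ∈ N)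
    (m : (freeFin n).NonemptyFlat →₀ ℕ) (hm : m.degree = k) : monomial m 1 ∈ N := by
  -- The induction raises the number of distinct proper subsets in the support, which is bounded by
  -- the number of all nonempty subsets.
  let μ : ((freeFin n).NonemptyFlat →₀ ℕ) → ℕ := fun m =>
    (m.support.filter (fun S => S.1 ≠ Finset.univ)).card
  induction hd : Fintype.card (freeFin n).NonemptyFlat - μ m using Nat.strong_induction_on
    generalizing m with
  | _ d ih =>
  by_cases hC : IsChain (· ≤ ·) (m.support : Set (freeFin n).NonemptyFlat)
  swap
  · exact hinc m hm hC
  by_cases hex : ∃ S ∈ m.support, S.1 = Finset.univ ∨ 2 ≤ m S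
  swap
  · push Not at hex
    have hm1 : ∀ S ∈ m.support, m S = 1 := fun S hS => by
      have h1 := (hex S hS).2
      have h2 := Finsupp.mem_support_iff.1 hS
      omega
    have hprod : monomial m (1 : ℤ) = ∏ S ∈ m.support, X S := by
      rw [monomial_eq, Finsupp.prod, C_1, one_mul]
      exact Finset.prod_congr rfl fun S hS => by rw [hm1 S hS, pow_one]
    rw [hprod]
    refine hchain _ hC (fun S hS => (hex S hS).1) ?_
    rw [← hm, Finsupp.degree_apply, Finset.card_eq_sum_ones]
    exact Finset.sum_congr rfl fun S hS => (hm1 S hS).symm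
  obtain ⟨S, hS, hSm⟩ := hex
  obtain ⟨m', rfl⟩ : ∃ m', m = m' + Finsupp.single S 1 := by
    refine ⟨m - Finsupp.single S 1, (tsub_add_cancel_of_le ?_).symm⟩
    rw [Finsupp.single_le_iff]
    exact Nat.one_le_iff_ne_zero.2 (Finsupp.mem_support_iff.1 hS)
  have hdeg : m'.degree + 1 = k := by
    rw [← hm, map_add, Finsupp.degree_single]
  have hdegT : ∀ T, (m' + Finsupp.single T 1).degree = k := fun T => by
    rw [map_add, Finsupp.degree_single, hdeg]
  rw [support_add_single] at hC
  -- Removing one copy of `S` costs no proper subset, since `S` is full or still present in `m'`; a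
  -- new proper `T` then raises `μ`.
  have hstep : ∀ T : (freeFin n).NonemptyFlat, T.1 ≠ Finset.univ → T ∉ m'.support →
      (S.1 = Finset.univ ∨ S ∈ m'.support) → monomial (m' + Finsupp.single T 1) (1 : ℤ) ∈ N := by
    intro T hT hTm hSor
    refine ih _ ?_ _ (hdegT T) rfl
    rw [← hd]
    have hlt : μ (m' + Finsupp.single S 1) < μ (m' + Finsupp.single T 1) := by
      refine Finset.card_lt_card ?_
      rw [Finset.ssubset_iff_of_subset]
      · refine ⟨T, by simp [support_add_single, hT], ?_⟩
        simp only [support_add_single, Finset.mem_filter, Finset.mem_insert, not_and]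
        rintro (h | h)
        · rcases hSor with h' | h'
          · exact fun h2 => h2 (h ▸ h')
          · exact absurd (h ▸ h') hTm
        · exact absurd h hTm
      · intro R
        simp only [support_add_single, Finset.mem_filter, Finset.mem_insert]
        rintro ⟨h | h, hR⟩
        · rcases hSor with h' | h'
          · exact absurd (h ▸ h') hR
          · exact ⟨Or.inr (h ▸ h'), hR⟩
        · exact ⟨Or.inr h, hR⟩
    have hle : μ (m' + Finsupp.single T 1) ≤ Fintype.card (freeFin n).NonemptyFlat :=
      Finset.card_le_univ _
    omega
  by_cases hSu : S.1 = Finset.univ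
  · obtain ⟨i, hiS, hi⟩ := exists_mem_notMem_of_lt hC S
    have h := hlin i m' hdeg
    rw [linearRelation_mul_monomial, ← Finset.add_sum_erase _ _
      (Finset.mem_filter.2 ⟨Finset.mem_univ S, hiS⟩)] at h
    refine (N.add_mem_iff_left ?_).1 h
    refine Submodule.sum_mem _ fun T hT => ?_
    obtain ⟨hTS, hT⟩ := Finset.mem_erase.1 hT
    have hiT := (Finset.mem_filter.1 hT).2
    have hlt : T < S := by
      refine lt_of_le_of_ne (show T.1 ⊆ S.1 from ?_) hTS
      rw [hSu]; exact Finset.subset_univ _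
    refine hstep T (fun h' => hTS (Subtype.ext (h'.trans hSu.symm))) (fun h' => ?_) (Or.inl hSu)
    exact hi T (Finset.mem_insert_of_mem h') hlt hiT
  · have hSm' : S ∈ m'.support := by
      have h2 := hSm.resolve_left hSu
      rw [Finsupp.add_apply, Finsupp.single_eq_same] at h2
      exact Finsupp.mem_support_iff.2 (by omega)
    obtain ⟨i, hiS, hi⟩ := exists_mem_notMem_of_lt hC S
    obtain ⟨j, hjS, hj⟩ := exists_notMem_mem_of_lt hC hSu
    -- In the difference, sets with `j` but not `i` are incomparable to `S`. A set with `i` but not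
    -- `j`, other than `S`, cannot lie in the chain, by the choice of `i` and `j`, so `hstep`
    -- applies.
    have h := N.sub_mem (hlin i m' hdeg) (hlin j m' hdeg)
    have hnon : ∀ T : (freeFin n).NonemptyFlat, ¬ T ≤ S → ¬ S ≤ T →
        monomial (m' + Finsupp.single T 1) (1 : ℤ) ∈ N := fun T h1 h2 => by
      refine hinc _ (hdegT T) fun hch => ?_
      rw [support_add_single] at hch
      rcases hch.total (Finset.mem_coe.2 (Finset.mem_insert_self _ _))
        (Finset.mem_coe.2 (Finset.mem_insert_of_mem hSm')) with h' | h'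
      exacts [h1 h', h2 h']
    have key : linearRelation i * monomial m' 1 - linearRelation j * monomial m' 1 =
        (∑ T : (freeFin n).NonemptyFlat with i ∈ T.1 ∧ j ∉ T.1,
          monomial (m' + Finsupp.single T 1) (1 : ℤ)) -
        ∑ T : (freeFin n).NonemptyFlat with j ∈ T.1 ∧ i ∉ T.1,
          monomial (m' + Finsupp.single T 1) (1 : ℤ) := by
      simp only [linearRelation_mul_monomial, Finset.sum_filter, ← Finset.sum_sub_distrib]
      refine Finset.sum_congr rfl fun T _ => ?_
      by_cases h1 : i ∈ T.1 <;> by_cases h2 : j ∈ T.1 <;> simp [h1, h2]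
    rw [key] at h
    have h' := (N.sub_mem_iff_left (Submodule.sum_mem _ fun T hT => ?_)).1 h
    · rw [← Finset.add_sum_erase _ _
        (Finset.mem_filter.2 ⟨Finset.mem_univ S, hiS, hjS⟩)] at h'
      refine (N.add_mem_iff_left ?_).1 h'
      refine Submodule.sum_mem _ fun T hT => ?_
      obtain ⟨hTS, hT⟩ := Finset.mem_erase.1 hT
      obtain ⟨-, hiT, hjT⟩ := Finset.mem_filter.1 hT
      refine hstep T (fun h' => hjT (h' ▸ Finset.mem_univ j)) (fun h' => ?_) (Or.inr hSm')
      have hTC : T ∈ insert S m'.support := Finset.mem_insert_of_mem h'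
      rcases hC.total hTC (Finset.mem_insert_self S _) with h2 | h2
      · exact hi T hTC (lt_of_le_of_ne h2 hTS) hiT
      · exact hjT (hj T hTC (lt_of_le_of_ne h2 (Ne.symm hTS)))
    · obtain ⟨-, hjT, hiT⟩ := Finset.mem_filter.1 hT
      exact hnon T (fun h' => hjS (h' hjT)) (fun h' => hiT (h' hiS))


/-! ### Localization at the fixed points of the permutohedral variety -/

/-- The `k`-th member of the complete flag of an ordering `π` of `[n]`: its first `k` elements. -/
def permFlag {n : ℕ} (π : Equiv.Perm (Fin n)) (k : ℕ) : Finset (Fin n) :=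
  Finset.univ.filter fun e => (π e : ℕ) < k

theorem mem_permFlag {n : ℕ} {π : Equiv.Perm (Fin n)} {k : ℕ} {e : Fin n} :
    e ∈ permFlag π k ↔ (π e : ℕ) < k := by simp [permFlag]

theorem card_permFlag {n : ℕ} (π : Equiv.Perm (Fin n)) {k : ℕ} (hk : k ≤ n) :
    (permFlag π k).card = k := by
  have h : permFlag π k = (Finset.univ.filter fun i : Fin n => (i : ℕ) < k).map
      π.symm.toEmbedding := by
    ext e
    simp [mem_permFlag]
  rw [h, Finset.card_map, Fin.card_filter_val_lt]
  exact min_eq_right hk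

theorem permFlag_mono {n : ℕ} (π : Equiv.Perm (Fin n)) : Monotone (permFlag π) :=
  fun _ _ hkl _ he => mem_permFlag.2 ((mem_permFlag.1 he).trans_le hkl)

theorem perm_eq_of_permFlag_eq {n : ℕ} {π ρ : Equiv.Perm (Fin n)}
    (h : ∀ k < n - 1, permFlag π (k + 1) = permFlag ρ (k + 1)) : π = ρ := by
  have hk : ∀ k ≤ n, ∀ e, (π e : ℕ) < k ↔ (ρ e : ℕ) < k := by
    intro k hk e
    rcases k with _ | k
    · simp
    by_cases h' : k < n - 1
    · rw [← mem_permFlag, h k h', mem_permFlag]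
    · have h1 := (π e).2
      have h2 := (ρ e).2
      constructor <;> intro <;> omega
  ext e
  have h1 := (hk (π e) (π e).2.le e).not
  have h2 := (hk (ρ e) (ρ e).2.le e).not
  simp only [lt_irrefl, not_false_iff, true_iff, iff_true, not_lt] at h1 h2
  exact le_antisymm h1 h2

/-- The `k`-th element in the ordering `π`, as a rational number, and `0` beyond the end. -/
def orderedValue {n : ℕ} (π : Equiv.Perm (Fin n)) (k : ℕ) : ℚ :=
  if h : k < n then ((π.symm ⟨k, h⟩ : Fin n) : ℕ) else 0

/-- The value of the generator `x_S` at the fixed point of the permutohedral variety given by `π`. -/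
noncomputable def localization {n : ℕ} (π : Equiv.Perm (Fin n)) (S : (freeFin n).NonemptyFlat) :
    ℚ :=
  ∑ k ∈ Finset.range n, if S.1 = permFlag π (k + 1) then
    orderedValue π k - orderedValue π (k + 1) else 0

theorem exists_permFlag_of_localization_ne_zero {n : ℕ} {π : Equiv.Perm (Fin n)}
    {S : (freeFin n).NonemptyFlat} (h : localization π S ≠ 0) : S.1 = permFlag π S.1.card := by
  obtain ⟨k, hk, hk'⟩ := Finset.exists_ne_zero_of_sum_ne_zero h
  have hS : S.1 = permFlag π (k + 1) := by
    by_contra h'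
    exact hk' (if_neg h')
  rw [hS, card_permFlag π (Finset.mem_range.1 hk)]

theorem localization_of_eq_permFlag {n : ℕ} {π : Equiv.Perm (Fin n)}
    {S : (freeFin n).NonemptyFlat} {k : ℕ} (hk : k < n) (h : S.1 = permFlag π (k + 1)) :
    localization π S = orderedValue π k - orderedValue π (k + 1) := by
  rw [localization, Finset.sum_eq_single_of_mem k (Finset.mem_range.2 hk), if_pos h]
  intro l hl hlk
  refine if_neg fun h' => hlk ?_
  have h1 := congrArg Finset.card (h.symm.trans h')
  rw [card_permFlag π hk, card_permFlag π (Finset.mem_range.1 hl)] at h1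
  omega

theorem permFlag_succ_nonempty {n : ℕ} (π : Equiv.Perm (Fin n)) {k : ℕ} (hk : k < n) :
    (permFlag π (k + 1)).Nonempty := by
  rw [← Finset.card_pos, card_permFlag π hk]
  omega

/-- The flag members containing `e` start at its position, so the differences telescope from the
value of `e` to the final value 0. -/
theorem sum_localization {n : ℕ} (π : Equiv.Perm (Fin n)) (e : Fin n) :
    ∑ S : (freeFin n).NonemptyFlat with e ∈ S.1, localization π S = (e : ℕ) := by
  simp only [localization]
  rw [Finset.sum_comm]
  have h : ∀ k ∈ Finset.range n,
      (∑ S : (freeFin n).NonemptyFlat with e ∈ S.1, if S.1 = permFlag π (k + 1) then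
        orderedValue π k - orderedValue π (k + 1) else 0) =
      if (π e : ℕ) ≤ k then orderedValue π k - orderedValue π (k + 1) else 0 := by
    intro k hk
    let F : (freeFin n).NonemptyFlat :=
      ⟨permFlag π (k + 1), permFlag_succ_nonempty π (Finset.mem_range.1 hk), isFlat_freeFin _⟩
    have hF : ∀ S : (freeFin n).NonemptyFlat, S.1 = permFlag π (k + 1) ↔ S = F := fun S =>
      ⟨fun h => Subtype.ext h, fun h => h ▸ rfl⟩
    simp only [hF, Finset.sum_ite_eq', Finset.mem_filter, Finset.mem_univ, true_and]
    have h2 : e ∈ F.1 ↔ (π e : ℕ) ≤ k := mem_permFlag.trans Nat.lt_succ_iff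
    simp only [h2]
  rw [Finset.sum_congr rfl h, ← Finset.sum_filter]
  have h3 : (Finset.range n).filter (fun k => (π e : ℕ) ≤ k) = Finset.Ico (π e : ℕ) n := by
    ext k; simp [and_comm]
  rw [h3]
  have h4 := Finset.sum_Ico_sub (fun k => -orderedValue π k) (π e).2.le
  have h5 : orderedValue π n = 0 := by simp [orderedValue]
  have h6 : orderedValue π (π e) = (e : ℕ) := by simp [orderedValue]
  simp only [h5, h6] at h4
  rw [neg_zero, zero_sub, neg_neg] at h4
  rw [← h4]
  exact Finset.sum_congr rfl fun k _ => by ring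

/-- The Euler class of the tangent space at the fixed point given by `π`. -/
noncomputable def eulerClass {n : ℕ} (π : Equiv.Perm (Fin n)) : ℚ :=
  ∏ k ∈ Finset.range (n - 1), (orderedValue π k - orderedValue π (k + 1))

theorem eulerClass_ne_zero {n : ℕ} (π : Equiv.Perm (Fin n)) : eulerClass π ≠ 0 := by
  refine Finset.prod_ne_zero_iff.2 fun k hk => ?_
  have hk' := Finset.mem_range.1 hk
  rw [orderedValue, orderedValue, dif_pos (by omega), dif_pos (by omega), sub_ne_zero]
  intro h
  have h1 := π.symm.injective (Fin.ext (Nat.cast_injective h))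
  simp at h1

/-- The equivariant degree map, as a sum over torus fixed points. -/
noncomputable def localizedDegree (n : ℕ) : MvPolynomial (freeFin n).NonemptyFlat ℤ →ₗ[ℤ] ℚ :=
  ∑ π : Equiv.Perm (Fin n), LinearMap.mulLeft ℤ (eulerClass π)⁻¹ ∘ₗ
    (aeval (R := ℤ) (localization π)).toLinearMap

theorem localizedDegree_apply {n : ℕ} (p : MvPolynomial (freeFin n).NonemptyFlat ℤ) :
    localizedDegree n p =
      ∑ π : Equiv.Perm (Fin n), (eulerClass π)⁻¹ * aeval (R := ℤ) (localization π) p := by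
  simp [localizedDegree]

/-- Equivariantly a linear relation acts as the scalar `t_e = e` rather than as zero; it dies only
once the remaining factor has degree 0 under the sum. -/
theorem localizedDegree_linearRelation_mul {n : ℕ} (e : Fin n)
    (p : MvPolynomial (freeFin n).NonemptyFlat ℤ) :
    localizedDegree n (linearRelation e * p) = (e : ℕ) * localizedDegree n p := by
  rw [localizedDegree_apply, localizedDegree_apply, Finset.mul_sum]
  refine Finset.sum_congr rfl fun π _ => ?_
  rw [map_mul, linearRelation, map_sum]
  simp only [aeval_X]
  rw [sum_localization]
  ring

/-- At each fixed point only members of a single flag have nonzero value, and these are comparable.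
-/
theorem localizedDegree_incomparable_mul {n : ℕ} {S T : (freeFin n).NonemptyFlat} (h1 : ¬ S ≤ T)
    (h2 : ¬ T ≤ S) (p : MvPolynomial (freeFin n).NonemptyFlat ℤ) :
    localizedDegree n (X S * X T * p) = 0 := by
  rw [localizedDegree_apply]
  refine Finset.sum_eq_zero fun π _ => ?_
  have h : localization π S * localization π T = 0 := by
    by_contra h
    have hS := exists_permFlag_of_localization_ne_zero (left_ne_zero_of_mul h)
    have hT := exists_permFlag_of_localization_ne_zero (right_ne_zero_of_mul h)
    rcases le_total S.1.card T.1.card with hle | hle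
    · refine h1 (show S.1 ⊆ T.1 from ?_)
      rw [hS, hT]; exact permFlag_mono π hle
    · refine h2 (show T.1 ⊆ S.1 from ?_)
      rw [hS, hT]; exact permFlag_mono π hle
  rw [map_mul, map_mul, aeval_X, aeval_X, h, zero_mul, mul_zero]

theorem exists_incomparable_of_not_isChain {n : ℕ} {m : (freeFin n).NonemptyFlat →₀ ℕ}
    (h : ¬ IsChain (· ≤ ·) (m.support : Set (freeFin n).NonemptyFlat)) :
    ∃ S T m', ¬ S ≤ T ∧ ¬ T ≤ S ∧ monomial m (1 : ℤ) = X S * X T * monomial m' 1 := by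
  simp only [IsChain, Set.Pairwise, not_forall, not_or] at h
  obtain ⟨S, hS, T, hT, hne, h1, h2⟩ := h
  refine ⟨S, T, m - (Finsupp.single S 1 + Finsupp.single T 1), h1, h2, ?_⟩
  rw [X, X, monomial_mul, monomial_mul, one_mul, one_mul, add_tsub_cancel_of_le]
  intro R
  have hS' := Finsupp.mem_support_iff.1 hS
  have hT' := Finsupp.mem_support_iff.1 hT
  simp only [Finsupp.add_apply, Finsupp.single_apply]
  split_ifs with h3 h4 h4
  · exact absurd (h3.trans h4.symm) hne
  all_goals first | (subst h3; omega) | (subst h4; omega) | omega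

/-! ### Maximal chains and orderings -/

theorem injOn_card_of_isChain {n : ℕ} {C : Finset (freeFin n).NonemptyFlat}
    (hC : IsChain (· ≤ ·) (C : Set (freeFin n).NonemptyFlat)) :
    Set.InjOn (fun S : (freeFin n).NonemptyFlat => S.1.card) C := by
  intro S hS T hT h
  rcases hC.total hS hT with h' | h'
  · exact Subtype.ext (Finset.eq_of_subset_of_card_le h' h.ge)
  · exact Subtype.ext (Finset.eq_of_subset_of_card_le h' h.le).symm

theorem image_card_subset {n : ℕ} {C : Finset (freeFin n).NonemptyFlat}
    (hu : ∀ S ∈ C, S.1 ≠ Finset.univ) :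
    C.image (fun S => S.1.card) ⊆ Finset.Icc 1 (n - 1) := by
  intro k hk
  obtain ⟨S, hS, rfl⟩ := Finset.mem_image.1 hk
  have h1 := Finset.card_pos.2 S.2.1
  have h2 := Finset.card_lt_univ_of_notMem (s := S.1) (x := _)
    (not_forall.1 fun h => hu S hS (Finset.eq_univ_of_forall h)).choose_spec
  rw [Fintype.card_fin] at h2
  rw [Finset.mem_Icc]
  omega

theorem card_le_of_isChain {n : ℕ} {C : Finset (freeFin n).NonemptyFlat}
    (hC : IsChain (· ≤ ·) (C : Set (freeFin n).NonemptyFlat)) (hu : ∀ S ∈ C, S.1 ≠ Finset.univ) :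
    C.card ≤ n - 1 := by
  rw [← Finset.card_image_of_injOn (injOn_card_of_isChain hC)]
  simpa using Finset.card_le_card (image_card_subset hu)

theorem exists_card_eq_of_isChain {n : ℕ} {C : Finset (freeFin n).NonemptyFlat}
    (hC : IsChain (· ≤ ·) (C : Set (freeFin n).NonemptyFlat)) (hu : ∀ S ∈ C, S.1 ≠ Finset.univ)
    (hcard : C.card = n - 1) {k : ℕ} (hk : k ∈ Finset.Icc 1 (n - 1)) :
    ∃ S ∈ C, S.1.card = k := by
  have h : C.image (fun S => S.1.card) = Finset.Icc 1 (n - 1) := by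
    refine Finset.eq_of_subset_of_card_le (image_card_subset hu) ?_
    rw [Finset.card_image_of_injOn (injOn_card_of_isChain hC), hcard]
    simp
  rw [← h] at hk
  exact Finset.mem_image.1 hk

/-- A chain of `n - 1` proper nonempty subsets is the complete flag of an ordering. -/
theorem exists_perm_of_isChain {n : ℕ} {C : Finset (freeFin n).NonemptyFlat}
    (hC : IsChain (· ≤ ·) (C : Set (freeFin n).NonemptyFlat)) (hu : ∀ S ∈ C, S.1 ≠ Finset.univ)
    (hcard : C.card = n - 1) :
    ∃ π : Equiv.Perm (Fin n), ∀ S ∈ C, S.1 = permFlag π S.1.card := by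
  -- The position of `e` is the number of chain members missing it: as every size from 1 to `n - 1`
  -- occurs once, `e` lies in `S` exactly when this number is below `|S|`.
  let h : Fin n → ℕ := fun e => (C.filter fun T => e ∉ T.1).card
  have hn : ∀ e, h e < n := fun e => by
    have h1 : h e ≤ C.card := Finset.card_filter_le _ _
    have h2 := e.2
    omega
  have hmem : ∀ S ∈ C, ∀ e, e ∈ S.1 ↔ h e < S.1.card := by
    intro S hS e
    have hSI := Finset.mem_Icc.1 (image_card_subset hu (Finset.mem_image_of_mem _ hS))
    constructor
    · intro he
      have h1 : (C.filter fun T => e ∉ T.1).image (fun T => T.1.card) ⊆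
          Finset.Icc 1 (S.1.card - 1) := by
        intro k hk
        obtain ⟨T, hT, rfl⟩ := Finset.mem_image.1 hk
        obtain ⟨hTC, heT⟩ := Finset.mem_filter.1 hT
        have hlt : T.1 ⊂ S.1 := by
          rcases hC.total hTC hS with h' | h'
          · exact Finset.ssubset_iff_subset_ne.2 ⟨h', fun h2 => heT (h2 ▸ he)⟩
          · exact absurd (h' he) heT
        have h2 := Finset.card_lt_card hlt
        have h3 := Finset.card_pos.2 T.2.1
        rw [Finset.mem_Icc]
        omega
      have h2 := Finset.card_le_card h1
      rw [Finset.card_image_of_injOn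
        ((injOn_card_of_isChain hC).mono (Finset.coe_subset.2 (Finset.filter_subset _ _))),
        Nat.card_Icc] at h2
      change h e ≤ _ at h2
      omega
    · intro hlt
      by_contra he
      have h1 : Finset.Icc 1 S.1.card ⊆ (C.filter fun T => e ∉ T.1).image (fun T => T.1.card) := by
        intro k hk
        rw [Finset.mem_Icc] at hk
        obtain ⟨T, hT, hTk⟩ := exists_card_eq_of_isChain hC hu hcard
          (Finset.mem_Icc.2 ⟨hk.1, hk.2.trans hSI.2⟩)
        refine Finset.mem_image.2 ⟨T, Finset.mem_filter.2 ⟨hT, fun heT => he ?_⟩, hTk⟩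
        rcases hC.total hT hS with h' | h'
        · exact h' heT
        · rw [Finset.eq_of_subset_of_card_le h' (hTk.trans_le hk.2)]
          exact heT
      have h2 := (Finset.card_le_card h1).trans Finset.card_image_le
      rw [Nat.card_Icc] at h2
      change _ ≤ h e at h2
      omega
  have hcount : ∀ k ≤ n, (Finset.univ.filter fun e => h e < k).card = k := by
    intro k hk
    by_cases hk0 : k ∈ Finset.Icc 1 (n - 1)
    · obtain ⟨S, hS, rfl⟩ := exists_card_eq_of_isChain hC hu hcard hk0
      congr 1
      ext e
      simp [hmem S hS]
    · rw [Finset.mem_Icc] at hk0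
      rcases Nat.eq_zero_or_pos k with rfl | hpos
      · simp
      · obtain rfl : k = n := by omega
        simp [hn]
  have hsurj : Function.Surjective (fun e => (⟨h e, hn e⟩ : Fin n)) := by
    intro k
    obtain ⟨e, he1, he2⟩ := Finset.exists_mem_notMem_of_card_lt_card
      (s := Finset.univ.filter fun e => h e < (k : ℕ))
      (t := Finset.univ.filter fun e => h e < (k : ℕ) + 1) (by
        rw [hcount _ k.2.le, hcount _ k.2]; exact Nat.lt_succ_self _)
    simp only [Finset.mem_filter, Finset.mem_univ, true_and] at he1 he2
    exact ⟨e, Fin.ext (by simp only; omega)⟩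
  refine ⟨Equiv.ofBijective _ (Finite.surjective_iff_bijective.1 hsurj), fun S hS => ?_⟩
  ext e
  rw [hmem S hS, mem_permFlag]
  rfl

/-- Only the ordering whose flag is `C` contributes, and there the product equals the Euler class.
-/
theorem localizedDegree_prod_of_card_eq {n : ℕ} {C : Finset (freeFin n).NonemptyFlat}
    (hC : IsChain (· ≤ ·) (C : Set (freeFin n).NonemptyFlat)) (hu : ∀ S ∈ C, S.1 ≠ Finset.univ)
    (hcard : C.card = n - 1) : localizedDegree n (∏ S ∈ C, X S) = 1 := by
  obtain ⟨π, hπ⟩ := exists_perm_of_isChain hC hu hcard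
  have hI : ∀ S ∈ C, 1 ≤ S.1.card ∧ S.1.card ≤ n - 1 := fun S hS =>
    Finset.mem_Icc.1 (image_card_subset hu (Finset.mem_image_of_mem _ hS))
  have hk : ∀ k < n - 1, ∃ S ∈ C, S.1.card = k + 1 := fun k hk =>
    exists_card_eq_of_isChain hC hu hcard (Finset.mem_Icc.2 ⟨by omega, by omega⟩)
  rw [localizedDegree_apply, Finset.sum_eq_single_of_mem π (Finset.mem_univ _)]
  · rw [map_prod]
    simp only [aeval_X]
    rw [inv_mul_eq_one₀ (eulerClass_ne_zero π)]
    symm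
    refine Finset.prod_nbij (fun S => S.1.card - 1) ?_ ?_ ?_ ?_
    · intro S hS
      have := hI S hS
      rw [Finset.mem_range]
      omega
    · intro S hS T hT h
      have h1 := hI S hS
      have h2 := hI T hT
      exact injOn_card_of_isChain hC hS hT (by simp only at h ⊢; omega)
    · intro k hk'
      obtain ⟨S, hS, h⟩ := hk k (Finset.mem_range.1 hk')
      exact ⟨S, hS, by simp only; omega⟩
    · intro S hS
      have h1 := hI S hS
      refine localization_of_eq_permFlag (by omega) ?_
      rw [Nat.sub_add_cancel h1.1]
      exact hπ S hS
  · intro ρ _ hρ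
    rw [map_prod]
    simp only [aeval_X]
    refine mul_eq_zero_of_right _ ?_
    by_contra h
    refine hρ (perm_eq_of_permFlag_eq fun k hk' => ?_)
    obtain ⟨S, hS, hSk⟩ := hk k hk'
    have h1 := exists_permFlag_of_localization_ne_zero (Finset.prod_ne_zero_iff.1 h S hS)
    rw [← hSk, ← h1, ← hπ S hS]

/-! ### Vanishing of the localized degree below the top degree -/

/-- The action of a permutation of `[n]` on the nonempty subsets. -/
def permuteFlat {n : ℕ} (σ : Equiv.Perm (Fin n)) (S : (freeFin n).NonemptyFlat) :
    (freeFin n).NonemptyFlat :=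
  ⟨S.1.map σ.toEmbedding, S.2.1.map, isFlat_freeFin _⟩

theorem mem_permuteFlat {n : ℕ} {σ : Equiv.Perm (Fin n)} {S : (freeFin n).NonemptyFlat}
    {e : Fin n} : e ∈ (permuteFlat σ S).1 ↔ σ.symm e ∈ S.1 :=
  Finset.mem_map_equiv

theorem permuteFlat_le {n : ℕ} {σ : Equiv.Perm (Fin n)} {S T : (freeFin n).NonemptyFlat} :
    permuteFlat σ S ≤ permuteFlat σ T ↔ S ≤ T :=
  Finset.map_subset_map

theorem permuteFlat_swap_swap {n : ℕ} (i j : Fin n) (S : (freeFin n).NonemptyFlat) :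
    permuteFlat (Equiv.swap i j) (permuteFlat (Equiv.swap i j) S) = S := by
  refine Subtype.ext (Finset.ext fun e => ?_)
  simp [mem_permuteFlat]

theorem permuteFlat_swap_eq_self {n : ℕ} {i j : Fin n} {S : (freeFin n).NonemptyFlat}
    (h : i ∈ S.1 ↔ j ∈ S.1) : permuteFlat (Equiv.swap i j) S = S := by
  refine Subtype.ext (Finset.ext fun e => ?_)
  rw [mem_permuteFlat, Equiv.symm_swap]
  rcases eq_or_ne e i with rfl | h1
  · rw [Equiv.swap_apply_left, h]
  rcases eq_or_ne e j with rfl | h2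
  · rw [Equiv.swap_apply_right, h]
  · rw [Equiv.swap_apply_of_ne_of_ne h1 h2]

/-- A chain with fewer than `n - 1` members fails to separate some two elements. -/
theorem exists_not_separated {n : ℕ} {C : Finset (freeFin n).NonemptyFlat}
    (hC : IsChain (· ≤ ·) (C : Set (freeFin n).NonemptyFlat)) (hcard : C.card < n - 1) :
    ∃ i j, i ≠ j ∧ ∀ S ∈ C, (i ∈ S.1 ↔ j ∈ S.1) := by
  -- The number of members missing an element takes at most `|C| + 1 < n` values. In a chain, equal
  -- counts force the same members to be missed.
  obtain ⟨i, j, hij, h⟩ := Fintype.exists_ne_map_eq_of_card_lt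
    (fun e : Fin n => (⟨(C.filter fun T : (freeFin n).NonemptyFlat => e ∉ T.1).card,
      Nat.lt_succ_of_le (Finset.card_filter_le _ _)⟩ : Fin (C.card + 1))) (by simp; omega)
  have h : (C.filter fun T => i ∉ T.1).card = (C.filter fun T => j ∉ T.1).card :=
    congrArg Fin.val h
  have hor : (C.filter fun T => i ∉ T.1) ⊆ (C.filter fun T => j ∉ T.1) ∨
      (C.filter fun T => j ∉ T.1) ⊆ (C.filter fun T => i ∉ T.1) := by
    by_contra hcon
    rw [not_or, Finset.not_subset, Finset.not_subset] at hcon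
    obtain ⟨⟨S, hS, hS'⟩, T, hT, hT'⟩ := hcon
    simp only [Finset.mem_filter, not_and, not_not] at hS hS' hT hT'
    rcases hC.total hS.1 hT.1 with h' | h'
    · exact hT.2 (h' (hS' hS.1))
    · exact hS.2 (h' (hT' hT.1))
  have heq : (C.filter fun T => i ∉ T.1) = (C.filter fun T => j ∉ T.1) := by
    rcases hor with h' | h'
    · exact Finset.eq_of_subset_of_card_le h' h.ge
    · exact (Finset.eq_of_subset_of_card_le h' h.le).symm
  refine ⟨i, j, hij, fun S hS => ?_⟩
  have h1 := Finset.ext_iff.1 heq S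
  simp only [Finset.mem_filter, hS, true_and] at h1
  exact not_iff_not.1 h1

/-- Swapping two elements `i ≠ j` that `C` does not separate preserves the degree of every `x_T ∏
x_S`. The linear relations of `i` and `j` thus give the same value, although they scale the degree
of `∏ x_S` by `i` and by `j`. -/
theorem localizedDegree_prod_eq_zero {n : ℕ} {C : Finset (freeFin n).NonemptyFlat}
    (hC : IsChain (· ≤ ·) (C : Set (freeFin n).NonemptyFlat)) (hu : ∀ S ∈ C, S.1 ≠ Finset.univ)
    (hcard : C.card < n - 1) {c : ℚ}
    (hc : ∀ C' : Finset (freeFin n).NonemptyFlat,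
      IsChain (· ≤ ·) (C' : Set (freeFin n).NonemptyFlat) → (∀ S ∈ C', S.1 ≠ Finset.univ) →
      C'.card = C.card + 1 → localizedDegree n (∏ S ∈ C', X S) = c) :
    localizedDegree n (∏ S ∈ C, X S) = 0 := by
  obtain ⟨i, j, hij, hsep⟩ := exists_not_separated hC hcard
  have hval : ∀ T : (freeFin n).NonemptyFlat, ¬ (i ∈ T.1 ↔ j ∈ T.1) →
      localizedDegree n (X T * ∏ S ∈ C, X S) =
        if ∀ S ∈ C, T ≤ S ∨ S ≤ T then c else 0 := by
    intro T hT
    have hTC : T ∉ C := fun h => hT (hsep T h)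
    split_ifs with h
    · rw [← Finset.prod_insert (f := fun S => X S) hTC]
      refine hc _ ?_ ?_ (Finset.card_insert_of_notMem hTC)
      · rw [Finset.coe_insert]
        exact hC.insert fun S hS _ => h S hS
      · intro S hS
        rcases Finset.mem_insert.1 hS with rfl | hS
        · intro h'
          exact hT (by simp [h'])
        · exact hu S hS
    · push Not at h
      obtain ⟨S, hS, h1, h2⟩ := h
      rw [← Finset.mul_prod_erase C _ hS, ← mul_assoc]
      exact localizedDegree_incomparable_mul h1 h2 _
  have hswap : ∀ T : (freeFin n).NonemptyFlat,
      localizedDegree n (X T * ∏ S ∈ C, X S) =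
        localizedDegree n (X (permuteFlat (Equiv.swap i j) T) * ∏ S ∈ C, X S) := by
    intro T
    by_cases hT : i ∈ T.1 ↔ j ∈ T.1
    · rw [permuteFlat_swap_eq_self hT]
    · rw [hval T hT, hval _ (by simpa [mem_permuteFlat] using fun h => hT h.symm)]
      refine if_congr (forall₂_congr fun S hS => ?_) rfl rfl
      rw [← permuteFlat_le (σ := Equiv.swap i j) (S := T),
        ← permuteFlat_le (σ := Equiv.swap i j) (T := T), permuteFlat_swap_eq_self (hsep S hS)]
  have hlin : ∀ e : Fin n, (e : ℕ) * localizedDegree n (∏ S ∈ C, X S) =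
      ∑ T : (freeFin n).NonemptyFlat with e ∈ T.1, localizedDegree n (X T * ∏ S ∈ C, X S) := by
    intro e
    rw [← localizedDegree_linearRelation_mul, linearRelation, Finset.sum_mul, map_sum]
  have heq : (i : ℕ) * localizedDegree n (∏ S ∈ C, X S) =
      (j : ℕ) * localizedDegree n (∏ S ∈ C, X S) := by
    rw [hlin i, hlin j]
    refine Finset.sum_nbij' (permuteFlat (Equiv.swap i j)) (permuteFlat (Equiv.swap i j))
      ?_ ?_ (fun T _ => permuteFlat_swap_swap i j T) (fun T _ => permuteFlat_swap_swap i j T)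
      (fun T _ => hswap T)
    all_goals
      intro T hT
      simpa [mem_permuteFlat] using hT
  by_contra h
  exact hij (Fin.ext (Nat.cast_injective (mul_right_cancel₀ h heq)))

theorem localizedDegree_prod_of_card_lt {n : ℕ} {C : Finset (freeFin n).NonemptyFlat}
    (hC : IsChain (· ≤ ·) (C : Set (freeFin n).NonemptyFlat)) (hu : ∀ S ∈ C, S.1 ≠ Finset.univ)
    (hcard : C.card < n - 1) : localizedDegree n (∏ S ∈ C, X S) = 0 := by
  induction hd : n - 1 - C.card generalizing C with
  | zero => omega
  | succ d ih =>
    -- Chains of `n - 2` members extend to complete flags, of common value 1; shorter ones extend to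
    -- chains of value 0 by induction.
    rcases Nat.eq_zero_or_pos d with rfl | hd'
    · exact localizedDegree_prod_eq_zero hC hu hcard (c := 1) fun C' hC' hu' hcard' =>
        localizedDegree_prod_of_card_eq hC' hu' (by omega)
    · exact localizedDegree_prod_eq_zero hC hu hcard (c := 0) fun C' hC' hu' hcard' =>
        ih hC' hu' (by omega) (by omega)

theorem localizedDegree_monomial {n : ℕ} (m : (freeFin n).NonemptyFlat →₀ ℕ)
    (hm : m.degree < n - 1) : localizedDegree n (monomial m 1) = 0 := by
  induction hk : m.degree generalizing m with
  | zero =>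
    refine monomial_mem_of_chain_mem (LinearMap.ker (localizedDegree n)) (k := 0) ?_ ?_ ?_ m hk
    · exact fun C hC hu hc => localizedDegree_prod_of_card_lt hC hu (by omega)
    · intro m hm hch
      obtain ⟨S, T, m', h1, h2, h3⟩ := exists_incomparable_of_not_isChain hch
      rw [LinearMap.mem_ker, h3, localizedDegree_incomparable_mul h1 h2]
    · exact fun e m h => by omega
  | succ k ih =>
    refine monomial_mem_of_chain_mem (LinearMap.ker (localizedDegree n)) (k := k + 1) ?_ ?_ ?_ m hk
    · exact fun C hC hu hc => localizedDegree_prod_of_card_lt hC hu (by omega)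
    · intro m hm hch
      obtain ⟨S, T, m', h1, h2, h3⟩ := exists_incomparable_of_not_isChain hch
      rw [LinearMap.mem_ker, h3, localizedDegree_incomparable_mul h1 h2]
    · intro e m h
      rw [LinearMap.mem_ker, localizedDegree_linearRelation_mul, ih m (by omega) (by omega),
        mul_zero]


/-! ### Passage to the Chow ring -/

theorem isHomogeneous_linearRelation {n : ℕ} (e : Fin n) :
    (linearRelation e : MvPolynomial (freeFin n).NonemptyFlat ℤ).IsHomogeneous 1 :=
  IsHomogeneous.sum _ _ _ fun S _ => isHomogeneous_X ℤ S

theorem linearRelation_mem_chowIdeal {n : ℕ} (e : Fin n) :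
    linearRelation e ∈ (freeFin n).chowIdeal := by
  refine Ideal.mem_sup_right (Ideal.subset_span ⟨e, by simp, ?_⟩)
  exact Finset.sum_congr (by ext; simp) fun _ _ => rfl

theorem incomparable_mem_chowIdeal {n : ℕ} {S T : (freeFin n).NonemptyFlat} (h1 : ¬ S ≤ T)
    (h2 : ¬ T ≤ S) : (X S * X T : MvPolynomial _ ℤ) ∈ (freeFin n).chowIdeal :=
  Ideal.mem_sup_left (Ideal.subset_span ⟨S, T, h1, h2, rfl⟩)

theorem localizedDegree_homogeneousComponent_mul {n d : ℕ}
    {g : MvPolynomial (freeFin n).NonemptyFlat ℤ} (hg : g.IsHomogeneous d)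
    (h : ∀ m : (freeFin n).NonemptyFlat →₀ ℕ, m.degree + d = n - 1 →
      localizedDegree n (g * monomial m 1) = 0) (q : MvPolynomial (freeFin n).NonemptyFlat ℤ) :
    localizedDegree n (homogeneousComponent (n - 1) (q * g)) = 0 := by
  induction q using MvPolynomial.induction_on' with
  | monomial m a =>
    have hm : (monomial m a * g).IsHomogeneous (m.degree + d) :=
      (isHomogeneous_monomial a rfl).mul hg
    rw [homogeneousComponent_of_mem ((mem_homogeneousSubmodule _ _).2 hm)]
    split_ifs with hd
    · have ha : monomial m a * g = a • (g * monomial m 1) := by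
        rw [mul_comm, ← mul_smul_comm, smul_monomial, smul_eq_mul, mul_one]
      rw [ha, map_smul, h m hd.symm, smul_zero]
    · exact map_zero _
  | add p q hp hq => rw [add_mul, map_add, map_add, hp, hq, add_zero]

theorem localizedDegree_eq_zero_of_mem_chowIdeal {n : ℕ}
    {p : MvPolynomial (freeFin n).NonemptyFlat ℤ} (hp : p ∈ (freeFin n).chowIdeal)
    (hhom : p.IsHomogeneous (n - 1)) : localizedDegree n p = 0 := by
  -- The claim for all multipliers `q` survives multiplication in the span induction; taking a
  -- component is needed because the intermediate elements need not be homogeneous.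
  have key : ∀ q, localizedDegree n (homogeneousComponent (n - 1) (q * p)) = 0 := by
    rw [chowIdeal, ← Ideal.span_union] at hp
    refine Submodule.span_induction ?_ ?_ ?_ ?_ hp
    · rintro g (⟨S, T, h1, h2, rfl⟩ | ⟨e, -, hg⟩)
      · refine localizedDegree_homogeneousComponent_mul
          ((isHomogeneous_X ℤ S).mul (isHomogeneous_X ℤ T)) fun m _ => ?_
        exact localizedDegree_incomparable_mul h1 h2 _
      · obtain rfl : g = linearRelation e :=
          hg.trans (Finset.sum_congr (by ext; simp) fun _ _ => rfl)
        refine localizedDegree_homogeneousComponent_mul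
          (isHomogeneous_linearRelation e) fun m hm => ?_
        exact (localizedDegree_linearRelation_mul e _).trans
          (mul_eq_zero_of_right _ (localizedDegree_monomial m (by omega)))
    · simp
    · intro x y _ _ hx hy q
      rw [mul_add, map_add, map_add, hx, hy, add_zero]
    · intro a x _ hx q
      rw [smul_eq_mul, ← mul_assoc]
      exact hx _
  have h := key 1
  rwa [one_mul, homogeneousComponent_of_mem ((mem_homogeneousSubmodule _ _).2 hhom),
    if_pos rfl] at h

/-- A graded piece of the Chow ring is spanned by the square-free chain monomials. -/
theorem chowGraded_le {n k : ℕ} (N : Submodule ℤ (freeFin n).ChowRing)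
    (hchain : ∀ C : Finset (freeFin n).NonemptyFlat,
      IsChain (· ≤ ·) (C : Set (freeFin n).NonemptyFlat) → (∀ S ∈ C, S.1 ≠ Finset.univ) →
      C.card = k → ∏ S ∈ C, (freeFin n).chowX S ∈ N) :
    (freeFin n).chowGraded k ≤ N := by
  rw [chowGraded, Submodule.map_le_iff_le_comap]
  intro p hp
  have hzero : ∀ q ∈ (freeFin n).chowIdeal,
      q ∈ N.comap (Ideal.Quotient.mkₐ ℤ (freeFin n).chowIdeal).toLinearMap := fun q hq => by
    have h : Ideal.Quotient.mkₐ ℤ (freeFin n).chowIdeal q = 0 := Ideal.Quotient.eq_zero_iff_mem.2 hq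
    rw [Submodule.mem_comap, AlgHom.toLinearMap_apply, h]
    exact N.zero_mem
  rw [p.as_sum]
  refine Submodule.sum_mem _ fun m hm => ?_
  have hdeg : m.degree = k := by
    rw [Finsupp.degree_eq_weight_one]
    exact (mem_homogeneousSubmodule _ _).1 hp (mem_support_iff.1 hm)
  rw [← mul_one (coeff m p), ← smul_eq_mul, ← smul_monomial]
  refine Submodule.smul_mem _ _ ?_
  refine monomial_mem_of_chain_mem _ ?_ ?_ ?_ m hdeg
  · intro C hC hu hcard
    rw [Submodule.mem_comap, AlgHom.toLinearMap_apply, map_prod]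
    exact hchain C hC hu hcard
  · intro m _ hch
    obtain ⟨S, T, m', h1, h2, h3⟩ := exists_incomparable_of_not_isChain hch
    rw [h3]
    exact hzero _ (Ideal.mul_mem_right _ _ (incomparable_mem_chowIdeal h1 h2))
  · exact fun e m _ => hzero _ (Ideal.mul_mem_right _ _ (linearRelation_mem_chowIdeal e))

theorem chowGraded_eq_bot {n k : ℕ} (hk : n - 1 < k) : (freeFin n).chowGraded k = ⊥ := by
  rw [eq_bot_iff]
  refine chowGraded_le _ fun C hC hu hcard => ?_
  have := card_le_of_isChain hC hu
  omega

/-! ### All complete flags have the same class -/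

/-- The proper members of the complete flag of an ordering, as flats of the free matroid. -/
def permFlat {n : ℕ} (π : Equiv.Perm (Fin n)) (k : Fin (n - 1)) : (freeFin n).NonemptyFlat :=
  ⟨permFlag π (k + 1), permFlag_succ_nonempty π (by omega), isFlat_freeFin _⟩

theorem card_permFlat {n : ℕ} (π : Equiv.Perm (Fin n)) (k : Fin (n - 1)) :
    (permFlat π k).1.card = k + 1 :=
  card_permFlag π (by omega)

theorem mem_permFlat {n : ℕ} {π : Equiv.Perm (Fin n)} {k : Fin (n - 1)} {e : Fin n} :
    e ∈ (permFlat π k).1 ↔ (π e : ℕ) < k + 1 :=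
  mem_permFlag

theorem permFlat_strictMono {n : ℕ} (π : Equiv.Perm (Fin n)) : StrictMono (permFlat π) := by
  refine Monotone.strictMono_of_injective (fun k l h => permFlag_mono π (by simpa using h)) ?_
  intro k l h
  have h1 := card_permFlat π k
  rw [h, card_permFlat] at h1
  exact Fin.ext (by omega)

theorem permFlat_ne_univ {n : ℕ} (π : Equiv.Perm (Fin n)) (k : Fin (n - 1)) :
    (permFlat π k).1 ≠ Finset.univ := by
  intro h
  have h1 := card_permFlat π k
  rw [h, Finset.card_univ, Fintype.card_fin] at h1
  omega

/-- The class of the monomial of the complete flag of an ordering. -/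
noncomputable def flagClass {n : ℕ} (π : Equiv.Perm (Fin n)) : (freeFin n).ChowRing :=
  ∏ k, (freeFin n).chowX (permFlat π k)

theorem exists_prod_chowX_eq_flagClass {n : ℕ} {C : Finset (freeFin n).NonemptyFlat}
    (hC : IsChain (· ≤ ·) (C : Set (freeFin n).NonemptyFlat)) (hu : ∀ S ∈ C, S.1 ≠ Finset.univ)
    (hcard : C.card = n - 1) : ∃ π, ∏ S ∈ C, (freeFin n).chowX S = flagClass π := by
  obtain ⟨π, hπ⟩ := exists_perm_of_isChain hC hu hcard
  refine ⟨π, ?_⟩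
  have h : C = Finset.univ.image (permFlat π) := by
    refine Finset.eq_of_subset_of_card_le (fun S hS => ?_) ?_
    · have h1 := Finset.mem_Icc.1 (image_card_subset hu (Finset.mem_image_of_mem _ hS))
      refine Finset.mem_image.2 ⟨⟨S.1.card - 1, by omega⟩, Finset.mem_univ _, Subtype.ext ?_⟩
      refine Eq.trans (congrArg (permFlag π) ?_) (hπ S hS).symm
      exact Nat.sub_add_cancel h1.1
    · refine Finset.card_image_le.trans ?_
      rw [Finset.card_univ, Fintype.card_fin, hcard]
  rw [h, Finset.prod_image (permFlat_strictMono π).injective.injOn, flagClass]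

/-- Only one way of completing a flag with one gap keeps a given element of the gap. -/
theorem sum_chowX_mul_eq_flagClass {n : ℕ} (π : Equiv.Perm (Fin n)) (k : Fin (n - 1)) {i j : Fin n}
    (hi : (π i : ℕ) = k) (hj : (π j : ℕ) = k + 1) :
    ∑ T : (freeFin n).NonemptyFlat with i ∈ T.1 ∧ j ∉ T.1,
      (freeFin n).chowX T * ∏ l ∈ Finset.univ.erase k, (freeFin n).chowX (permFlat π l) =
    flagClass π := by
  rw [Finset.sum_eq_single (permFlat π k)]
  · rw [Finset.mul_prod_erase _ (fun l => (freeFin n).chowX (permFlat π l)) (Finset.mem_univ k)]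
    rfl
  · intro T hT hne
    obtain ⟨-, hiT, hjT⟩ := Finset.mem_filter.1 hT
    by_cases hcomp : ∀ l ≠ k, T ≤ permFlat π l ∨ permFlat π l ≤ T
    · refine absurd (Subtype.ext (Finset.ext fun e => ?_)) hne
      rw [mem_permFlat]
      constructor
      · intro he
        by_contra hlt
        have hej : π e ≠ π j := fun h => hjT (π.injective h ▸ he)
        have hej' : (π e : ℕ) ≠ k + 1 := fun h => hej (Fin.ext (h.trans hj.symm))
        have he2 := (π e).2
        -- An element of `T` beyond position `k + 1` contradicts comparability with the next flag
        -- member, which contains `j`.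
        have hl : (k : ℕ) + 1 < n - 1 := by omega
        rcases hcomp ⟨k + 1, hl⟩ (fun h => by simpa using congrArg Fin.val h) with h | h
        · have := mem_permFlat.1 (h he)
          simp only at this
          omega
        · exact hjT (h (mem_permFlat.2 (by simp only; omega)))
      · intro he
        rcases eq_or_ne (π e : ℕ) k with hek | hek
        · rwa [π.injective (Fin.ext (hek.trans hi.symm) : π e = π i)]
        · have hl : (k : ℕ) - 1 < n - 1 := by omega
          rcases hcomp ⟨k - 1, hl⟩ (fun h => by
            have := congrArg Fin.val h
            simp only at this
            omega) with h | h
          · have := mem_permFlat.1 (h hiT)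
            simp only at this
            omega
          · exact h (mem_permFlat.2 (by simp only; omega))
    · push Not at hcomp
      obtain ⟨l, hl, h1, h2⟩ := hcomp
      have h0 : (freeFin n).chowX T * (freeFin n).chowX (permFlat π l) = 0 :=
        Ideal.Quotient.eq_zero_iff_mem.2 (incomparable_mem_chowIdeal h1 h2)
      rw [← Finset.mul_prod_erase _ (fun l => (freeFin n).chowX (permFlat π l))
        (Finset.mem_erase.2 ⟨hl, Finset.mem_univ l⟩), ← mul_assoc, h0, zero_mul]
  · intro h
    refine absurd (Finset.mem_filter.2 ⟨Finset.mem_univ _, ?_, ?_⟩) h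
    · rw [mem_permFlat]; omega
    · rw [mem_permFlat]; omega

theorem sum_chowX_eq_zero {n : ℕ} (e : Fin n) :
    ∑ T : (freeFin n).NonemptyFlat with e ∈ T.1, (freeFin n).chowX T = 0 := by
  have h := Ideal.Quotient.eq_zero_iff_mem.2 (linearRelation_mem_chowIdeal e)
  rwa [linearRelation, map_sum] at h

/-- The two flags differ in one member. Multiplying the difference of two linear relations by the
common factors leaves exactly one completion on each side. -/
theorem flagClass_swap_mul {n : ℕ} (π : Equiv.Perm (Fin n)) {a b : Fin n}
    (hab : (b : ℕ) = a + 1) : flagClass (Equiv.swap a b * π) = flagClass π := by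
  have hk : (a : ℕ) < n - 1 := by omega
  have h1 := sum_chowX_mul_eq_flagClass π ⟨a, hk⟩ (i := π.symm a) (j := π.symm b)
    (by simp) (by simp [hab])
  have h2 := sum_chowX_mul_eq_flagClass (Equiv.swap a b * π) ⟨a, hk⟩ (i := π.symm b)
    (j := π.symm a) (by simp) (by simp [hab])
  have hQ : ∏ l ∈ Finset.univ.erase (⟨a, hk⟩ : Fin (n - 1)),
      (freeFin n).chowX (permFlat (Equiv.swap a b * π) l) =
      ∏ l ∈ Finset.univ.erase ⟨a, hk⟩, (freeFin n).chowX (permFlat π l) := by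
    refine Finset.prod_congr rfl fun l hl => ?_
    have hla : (l : ℕ) ≠ a := fun h => (Finset.mem_erase.1 hl).1 (Fin.ext h)
    congr 1
    refine Subtype.ext (Finset.ext fun e => ?_)
    rw [mem_permFlat, mem_permFlat, Equiv.Perm.mul_apply]
    rcases eq_or_ne (π e) a with h | h
    · rw [h, Equiv.swap_apply_left]; omega
    rcases eq_or_ne (π e) b with h' | h'
    · rw [h', Equiv.swap_apply_right]; omega
    · rw [Equiv.swap_apply_of_ne_of_ne h h']
  rw [hQ] at h2
  rw [← h1, ← h2, ← sub_eq_zero]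
  set Q := ∏ l ∈ Finset.univ.erase (⟨a, hk⟩ : Fin (n - 1)), (freeFin n).chowX (permFlat π l)
  have h3 : (∑ T : (freeFin n).NonemptyFlat with π.symm b ∈ T.1, (freeFin n).chowX T) * Q -
      (∑ T : (freeFin n).NonemptyFlat with π.symm a ∈ T.1, (freeFin n).chowX T) * Q = 0 := by
    rw [sum_chowX_eq_zero, sum_chowX_eq_zero, sub_self]
  rw [← h3, Finset.sum_mul, Finset.sum_mul]
  simp only [Finset.sum_filter, ← Finset.sum_sub_distrib]
  refine Finset.sum_congr rfl fun T _ => ?_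
  by_cases ha : π.symm a ∈ T.1 <;> by_cases hb : π.symm b ∈ T.1 <;> simp [ha, hb]

/-- Adjacent transpositions generate the symmetric group. -/
theorem flagClass_eq_one {n : ℕ} (π : Equiv.Perm (Fin n)) : flagClass π = flagClass 1 := by
  rcases n with _ | n
  · rw [Subsingleton.elim π 1]
  have h : ∀ σ ∈ Submonoid.closure (Set.range fun i : Fin n => Equiv.swap i.castSucc i.succ),
      ∀ π : Equiv.Perm (Fin (n + 1)), flagClass (σ * π) = flagClass π := by
    intro σ hσ
    induction hσ using Submonoid.closure_induction with
    | mem x hx =>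
      obtain ⟨i, rfl⟩ := hx
      exact fun π => flagClass_swap_mul π (by simp)
    | one => exact fun π => by rw [one_mul]
    | mul x y _ _ hx hy => exact fun π => by rw [mul_assoc, hx, hy]
  have h1 := h π (by rw [Equiv.Perm.mclosure_swap_castSucc_succ]; trivial) 1
  rwa [mul_one] at h1

theorem chowGraded_le_span_flagClass (n : ℕ) :
    (freeFin n).chowGraded (n - 1) ≤ Submodule.span ℤ {flagClass 1} := by
  refine chowGraded_le _ fun C hC hu hcard => ?_
  obtain ⟨π, hπ⟩ := exists_prod_chowX_eq_flagClass hC hu hcard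
  rw [hπ, flagClass_eq_one π]
  exact Submodule.subset_span rfl

theorem prod_chowX_eq_flagClass {n : ℕ} {S : Fin (n - 1) → (freeFin n).NonemptyFlat}
    (hS : StrictMono S) (hu : ∀ i, (S i).1 ≠ Finset.univ) :
    ∏ i, (freeFin n).chowX (S i) = flagClass 1 := by
  obtain ⟨π, hπ⟩ := exists_prod_chowX_eq_flagClass (C := Finset.univ.image S)
    (by
      rw [Finset.coe_image, Finset.coe_univ, Set.image_univ]
      exact hS.monotone.isChain_range)
    (by simpa using hu)
    (by rw [Finset.card_image_of_injective _ hS.injective, Finset.card_univ, Fintype.card_fin])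
  rw [Finset.prod_image hS.injective.injOn] at hπ
  rw [hπ, flagClass_eq_one]

theorem localizedDegree_flag (n : ℕ) :
    localizedDegree n (∏ k, X (permFlat (1 : Equiv.Perm (Fin n)) k)) = 1 := by
  have hinj := (permFlat_strictMono (1 : Equiv.Perm (Fin n))).injective
  have h := localizedDegree_prod_of_card_eq (n := n)
    (C := Finset.univ.image (permFlat (1 : Equiv.Perm (Fin n))))
    (by
      rw [Finset.coe_image, Finset.coe_univ, Set.image_univ]
      exact (permFlat_strictMono _).monotone.isChain_range)
    (by simpa using permFlat_ne_univ _)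
    (by rw [Finset.card_image_of_injective _ hinj, Finset.card_univ, Fintype.card_fin])
  rwa [Finset.prod_image hinj.injOn] at h

/-- The coefficient of a top-degree class on the class of a flag is its localized degree. -/
theorem localizedDegree_eq_of_mk_eq {n : ℕ} {p : MvPolynomial (freeFin n).NonemptyFlat ℤ}
    (hp : p.IsHomogeneous (n - 1)) {c : ℤ}
    (h : Ideal.Quotient.mk (freeFin n).chowIdeal p = c • flagClass 1) :
    localizedDegree n p = c := by
  have hflag : (∏ k, X (permFlat (1 : Equiv.Perm (Fin n)) k) :
      MvPolynomial (freeFin n).NonemptyFlat ℤ).IsHomogeneous (n - 1) := by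
    have h := IsHomogeneous.prod Finset.univ
      (fun k => (X (permFlat (1 : Equiv.Perm (Fin n)) k) :
        MvPolynomial (freeFin n).NonemptyFlat ℤ)) (fun _ => 1) (fun k _ => isHomogeneous_X ℤ _)
    simpa using h
  have hmem : p - c • ∏ k, X (permFlat (1 : Equiv.Perm (Fin n)) k) ∈ (freeFin n).chowIdeal := by
    rw [← Ideal.Quotient.eq_zero_iff_mem, map_sub, h, map_zsmul, map_prod]
    exact sub_self _
  have h0 := localizedDegree_eq_zero_of_mem_chowIdeal hmem
    ((homogeneousSubmodule _ ℤ (n - 1)).sub_mem hp (Submodule.smul_mem _ c hflag))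
  rw [map_sub, map_smul, localizedDegree_flag, sub_eq_zero] at h0
  rw [h0, zsmul_one]

/-! ### The degree isomorphism -/

/-- The class of a flag, in the top graded piece of the Chow ring. -/
noncomputable def topFlagClass (n : ℕ) : (freeFin n).chowGraded (n - 1) :=
  ⟨∏ k, (freeFin n).chowX (permFlat 1 k), prod_chowX_mem_chowGraded _ _⟩

theorem exists_zsmul_topFlagClass {n : ℕ} (x : (freeFin n).chowGraded (n - 1)) :
    ∃ c : ℤ, c • topFlagClass n = x := by
  obtain ⟨c, hc⟩ := Submodule.mem_span_singleton.1 (chowGraded_le_span_flagClass n x.2)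
  exact ⟨c, Subtype.ext hc⟩

theorem zsmul_topFlagClass_injective (n : ℕ) :
    Function.Injective fun c : ℤ => c • topFlagClass n := by
  refine (injective_iff_map_eq_zero (LinearMap.toSpanSingleton ℤ _ (topFlagClass n))).2
    fun c hc => ?_
  have h1 : c • (flagClass 1 : (freeFin n).ChowRing) = 0 := congrArg Subtype.val hc
  -- If `c` times the flag class vanishes, 0 represents it, so `c` is the localized degree of 0.
  have h2 := localizedDegree_eq_of_mk_eq (n := n) (p := 0) (c := c)
    (isHomogeneous_zero _ _ _) (by rw [h1, map_zero])
  rw [map_zero] at h2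
  exact_mod_cast h2.symm

/-- The degree isomorphism of the Chow ring of the free matroid. -/
noncomputable def degreeIso (n : ℕ) : (freeFin n).chowGraded (n - 1) ≃ₗ[ℤ] ℤ :=
  (LinearEquiv.ofBijective (LinearMap.toSpanSingleton ℤ _ (topFlagClass n))
    ⟨zsmul_topFlagClass_injective n, exists_zsmul_topFlagClass⟩).symm

theorem degreeIso_topFlagClass (n : ℕ) : degreeIso n (topFlagClass n) = 1 := by
  rw [degreeIso, LinearEquiv.symm_apply_eq]
  exact (one_smul ℤ (topFlagClass n)).symm

theorem isDegreeIso_degreeIso (n : ℕ) : IsDegreeIso (degreeIso n) := by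
  intro S hS hu
  rw [← degreeIso_topFlagClass n]
  exact congrArg _ (Subtype.ext (prod_chowX_eq_flagClass hS hu))

theorem IsDegreeIso.apply_topFlagClass {n : ℕ} {deg : (freeFin n).chowGraded (n - 1) ≃ₗ[ℤ] ℤ}
    (h : IsDegreeIso deg) : deg (topFlagClass n) = 1 :=
  h _ (permFlat_strictMono 1) (permFlat_ne_univ 1)

theorem IsDegreeIso.eq_degreeIso {n : ℕ} {deg : (freeFin n).chowGraded (n - 1) ≃ₗ[ℤ] ℤ}
    (h : IsDegreeIso deg) : deg = degreeIso n := by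
  refine LinearEquiv.ext fun x => ?_
  obtain ⟨c, rfl⟩ := exists_zsmul_topFlagClass x
  rw [map_zsmul, map_zsmul, h.apply_topFlagClass, degreeIso_topFlagClass]

theorem IsDegreeIso.apply_mk {n : ℕ} {deg : (freeFin n).chowGraded (n - 1) ≃ₗ[ℤ] ℤ}
    (h : IsDegreeIso deg) {p : MvPolynomial (freeFin n).NonemptyFlat ℤ}
    (hp : p.IsHomogeneous (n - 1)) {x : (freeFin n).chowGraded (n - 1)}
    (hx : Ideal.Quotient.mk (freeFin n).chowIdeal p = x) : (deg x : ℚ) = localizedDegree n p := by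
  obtain ⟨c, rfl⟩ := exists_zsmul_topFlagClass x
  rw [localizedDegree_eq_of_mk_eq hp hx, map_zsmul, h.apply_topFlagClass, smul_eq_mul, mul_one]

/-! ### The product of the `z_k` and the rank-nullity ring -/

/-- The polynomial `∑_{|S| = k} x_S`. -/
noncomputable def permutahedralPolynomial (n k : ℕ) : MvPolynomial (freeFin n).NonemptyFlat ℤ :=
  ∑ S : (freeFin n).NonemptyFlat with S.1.card = k, X S

theorem mk_permutahedralPolynomial (n k : ℕ) :
    Ideal.Quotient.mk (freeFin n).chowIdeal (permutahedralPolynomial n k) = permutahedralZ n k := by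
  rw [permutahedralPolynomial, map_sum]
  rfl

theorem isHomogeneous_prod_permutahedralPolynomial (n : ℕ) :
    (∏ k ∈ Finset.Icc 1 (n - 1), permutahedralPolynomial n k).IsHomogeneous (n - 1) := by
  have h := IsHomogeneous.prod (Finset.Icc 1 (n - 1)) (permutahedralPolynomial n) (fun _ => 1)
    (fun k _ => IsHomogeneous.sum _ _ _ fun S _ => isHomogeneous_X ℤ S)
  simpa using h

/-- At each ordering at most one set of size `k`, the flag member, has nonzero value, so the product
restricts to the Euler class and every ordering contributes 1. -/
theorem localizedDegree_prod_permutahedralPolynomial (n : ℕ) :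
    localizedDegree n (∏ k ∈ Finset.Icc 1 (n - 1), permutahedralPolynomial n k) = n.factorial := by
  rw [localizedDegree_apply]
  have h : ∀ π : Equiv.Perm (Fin n), aeval (R := ℤ) (localization π)
      (∏ k ∈ Finset.Icc 1 (n - 1), permutahedralPolynomial n k) = eulerClass π := by
    intro π
    rw [map_prod, eulerClass]
    refine Finset.prod_nbij' (fun k => k - 1) (fun k => k + 1) ?_ ?_ ?_ ?_ ?_
    · intro k hk
      rw [Finset.mem_Icc] at hk
      rw [Finset.mem_range]
      omega
    · intro k hk
      rw [Finset.mem_range] at hk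
      rw [Finset.mem_Icc]
      omega
    · intro k hk
      rw [Finset.mem_Icc] at hk
      omega
    · intro k _
      omega
    · intro k hk
      rw [Finset.mem_Icc] at hk
      obtain ⟨l, rfl⟩ : ∃ l, k = l + 1 := ⟨k - 1, by omega⟩
      have hl : l < n - 1 := by omega
      rw [permutahedralPolynomial, map_sum]
      simp only [aeval_X, Nat.add_sub_cancel]
      rw [Finset.sum_eq_single_of_mem (permFlat π ⟨l, hl⟩)]
      · exact localization_of_eq_permFlag (by omega) rfl
      · exact Finset.mem_filter.2 ⟨Finset.mem_univ _, card_permFlat π _⟩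
      · intro S hS hne
        by_contra h0
        refine hne (Subtype.ext ?_)
        rw [exists_permFlag_of_localization_ne_zero h0, (Finset.mem_filter.1 hS).2]
        rfl
  simp only [h]
  rw [Finset.sum_congr rfl fun π _ => inv_mul_cancel₀ (eulerClass_ne_zero π)]
  simp [Fintype.card_perm]

theorem permutahedralZ_mem_rankNullityRing {n k : ℕ} (M : Matroid (Fin n)) (hk : k ≤ n) :
    permutahedralZ n k ∈ M.rankNullityRing := by
  have h : permutahedralZ n k = ∑ ij ∈ Finset.HasAntidiagonal.antidiagonal k, M.rankNullityY ij.1 ij.2 := by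
    simp only [permutahedralZ, rankNullityY, Finset.sum_filter]
    rw [Finset.sum_comm]
    refine Finset.sum_congr rfl fun S _ => ?_
    have hS : M.natRk S.1 + M.natNullity S.1 = S.1.card :=
      Nat.add_sub_cancel' (M.natRk_le_card S.1)
    rw [← Finset.sum_filter]
    split_ifs with hc
    · rw [Finset.sum_eq_single_of_mem (M.natRk S.1, M.natNullity S.1)]
      · simp [hS, hc]
      · intro ij hij hne
        obtain ⟨-, h1, h2⟩ := Finset.mem_filter.1 hij
        exact absurd (Prod.ext h1.symm h2.symm) hne
    · refine (Finset.sum_eq_zero fun ij hij => ?_).symm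
      obtain ⟨h0, h1, h2⟩ := Finset.mem_filter.1 hij
      rw [Finset.HasAntidiagonal.mem_antidiagonal] at h0
      omega
  rw [h]
  refine Subalgebra.sum_mem _ fun ij hij => Algebra.subset_adjoin ?_
  rw [Finset.HasAntidiagonal.mem_antidiagonal] at hij
  exact ⟨ij.1, by omega, ij.2, by omega, rfl⟩

theorem prod_permutahedralZ_mem {n : ℕ} (M : Matroid (Fin n)) :
    ∏ k ∈ Finset.Icc 1 (n - 1), permutahedralZ n k ∈ M.rankNullityGraded (n - 1) := by
  refine ⟨Subalgebra.prod_mem _ fun k hk => permutahedralZ_mem_rankNullityRing M ?_,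
    ∏ k ∈ Finset.Icc 1 (n - 1), permutahedralPolynomial n k,
    isHomogeneous_prod_permutahedralPolynomial n, ?_⟩
  · rw [Finset.mem_Icc] at hk
    omega
  · rw [AlgHom.toLinearMap_apply, map_prod]
    exact Finset.prod_congr rfl fun k _ => mk_permutahedralPolynomial n k

theorem IsDegreeIso.apply_prod_permutahedralZ {n : ℕ}
    {deg : (freeFin n).chowGraded (n - 1) ≃ₗ[ℤ] ℤ} (h : IsDegreeIso deg)
    (hf : ∏ k ∈ Finset.Icc 1 (n - 1), permutahedralZ n k ∈ (freeFin n).chowGraded (n - 1)) :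
    deg ⟨∏ k ∈ Finset.Icc 1 (n - 1), permutahedralZ n k, hf⟩ = (n.factorial : ℤ) := by
  have h1 := h.apply_mk (isHomogeneous_prod_permutahedralPolynomial n)
    (x := ⟨∏ k ∈ Finset.Icc 1 (n - 1), permutahedralZ n k, hf⟩) (by
      rw [map_prod]
      exact Finset.prod_congr rfl fun k _ => mk_permutahedralPolynomial n k)
  rw [localizedDegree_prod_permutahedralPolynomial] at h1
  exact_mod_cast h1

/-- The degree embeds this piece in `ℤ`, and the element of degree `n!` keeps it from being zero. -/
theorem finrank_rankNullityGraded {n : ℕ} (M : Matroid (Fin n)) :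
    Module.finrank ℤ (M.rankNullityGraded (n - 1)) = 1 := by
  let f : M.rankNullityGraded (n - 1) →ₗ[ℤ] ℤ :=
    (degreeIso n).toLinearMap ∘ₗ Submodule.inclusion inf_le_right
  have hf : Function.Injective f :=
    (degreeIso n).injective.comp (Submodule.inclusion_injective _)
  have : Module.Finite ℤ (M.rankNullityGraded (n - 1)) := Module.Finite.of_injective f hf
  have : Module.IsTorsionFree ℤ (M.rankNullityGraded (n - 1)) := hf.moduleIsTorsionFree f (by simp)
  have : Nontrivial (M.rankNullityGraded (n - 1)) := by
    refine ⟨⟨⟨_, prod_permutahedralZ_mem M⟩, 0, fun h0 => ?_⟩⟩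
    have h1 : f ⟨_, prod_permutahedralZ_mem M⟩ = (n.factorial : ℤ) :=
      (isDegreeIso_degreeIso n).apply_prod_permutahedralZ (prod_permutahedralZ_mem M).2
    rw [h0, map_zero] at h1
    exact n.factorial_ne_zero (by exact_mod_cast h1.symm)
  refine le_antisymm ?_ Module.finrank_pos
  simpa using LinearMap.finrank_le_finrank_of_injective hf

end Matroid

theorem mainTheorem10 (n : ℕ) (hn : 1 ≤ n) (M : Matroid (Fin n)) (hM : M.E = Set.univ) :
    -- the graded piece of degree `n - 1` has rank one, and all higher ones vanish
    Module.finrank ℤ (M.rankNullityGraded (n - 1)) = 1 ∧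
    (∀ k : ℕ, n - 1 < k → M.rankNullityGraded k = ⊥) ∧
    -- the degree isomorphism exists and is unique
    (∃! deg : (Matroid.freeFin n).chowGraded (n - 1) ≃ₗ[ℤ] ℤ, Matroid.IsDegreeIso deg) ∧
    -- the product `z_1 ⋯ z_{n-1}` lies in the rank-nullity ring and has degree `n!`
    ∃ hf : ∏ k ∈ Finset.Icc 1 (n - 1), Matroid.permutahedralZ n k ∈ M.rankNullityGraded (n - 1),
      ∀ deg : (Matroid.freeFin n).chowGraded (n - 1) ≃ₗ[ℤ] ℤ, Matroid.IsDegreeIso deg →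
        deg ⟨∏ k ∈ Finset.Icc 1 (n - 1), Matroid.permutahedralZ n k, hf.2⟩ = (n.factorial : ℤ) := by
  refine ⟨M.finrank_rankNullityGraded, fun k hk => ?_,
    ⟨Matroid.degreeIso n, Matroid.isDegreeIso_degreeIso n, fun deg h => h.eq_degreeIso⟩,
    M.prod_permutahedralZ_mem, fun deg h => h.apply_prod_permutahedralZ _⟩
  rw [Matroid.rankNullityGraded, Matroid.chowGraded_eq_bot hk, inf_bot_eq]
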